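/- \textbf{Theorem.} Let $\mathbb{C}$ be an exact category (in the sense of Barr), that is, $\mathbb{C}$ has finite limits and coequalizers of kernel pairs, regular epimorphisms in $\mathbb{C}$ are stable under pullback, and every internal equivalence relation in $\mathbb{C}$ is the kernel pair of some morphism. Suppose that $\mathbb{C}$ satisfies the following condition: \begin{enumerate} \item[(a)] finite coproducts exist in $\mathbb{C}$; \item[(b)] binary coproducts of pullback squares are pullback squares in $\mathbb{C}$; \item[(c)] for each monomorphism $m:S\to A$ in $\mathbb{C}$, the commutative square with top $m+1_S:S+S\to A+S$, left side $[1_S,1_S]:S+S\to S$, right side $[1_A,m]:A+S\to A$ and bottom $m:S\to A$ is a pullback; \item[(d)] for each regular epimorphism $p:E\to B$ in $\mathbb{C}$, the commutative square with top $p+p:E+E\to B+B$, left side $[1_E,1_E]:E+E\to E$, right side $[1_B,1_B]:B+B\to B$ and bottom $p:E\to B$ is a feeble pullback, meaning that the induced morphism from $E+E$ to the pullback of $p$ and $[1_B,1_B]$ is a regular epimorphism. \end{enumerate} If $\mathbb{C}$ has finite colimits, then $\mathbb{C}$ is coexact, that is, the opposite category $\mathbb{C}^{\mathrm{op}}$ is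 exact. -/

import Mathlib

open CategoryTheory CategoryTheory.Limits

universe v u

/-- A category is (Barr-)exact if it is regular and every internal equivalence relation in it
is the kernel pair of some morphism. -/
class BarrExact (C : Type u) [Category.{v} C] : Prop extends Regular C where
  /-- equivalence relations are effective -/
  exists_isKernelPair : ∀ {R A : C} (r₁ r₂ : R ⟶ A), IsEquivalenceRelation r₁ r₂ →
    ∃ (B : C) (q : A ⟶ B), IsKernelPair q r₁ r₂

/-- A category is coexact if its opposite category is exact. -/
def BarrCoexact (C : Type u) [Category.{v} C] : Prop :=
  BarrExact Cᵒᵖ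

/-- The square
```
  A --f--> B
  |        |
  α        β
  v        v
  A' -f'-> B'
```
is a feeble pullback if it commutes and the unique induced morphism from `A` to the pullback of
`f'` and `β` is a regular epimorphism. -/
def IsFeeblePullback {C : Type u} [Category.{v} C] [HasFiniteLimits C] {A B A' B' : C}
    (f : A ⟶ B) (α : A ⟶ A') (β : B ⟶ B') (f' : A' ⟶ B') : Prop :=
  ∃ w : α ≫ f' = f ≫ β, IsRegularEpi (pullback.lift α f w : A ⟶ pullback f' β)

/-- The condition on a category with finite limits that
(a) finite coproducts exist;
(b) binary coproducts of pullback squares are pullback squares;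
(c) for each monomorphism `m : S ⟶ A`, the square formed by `m + 1 : S + S ⟶ A + S`,
`[1, 1] : S + S ⟶ S`, `[1, m] : A + S ⟶ A` and `m` is a pullback;
(d) for each regular epimorphism `p : E ⟶ B`, the square formed by `p + p : E + E ⟶ B + B`,
the codiagonals of `E` and `B`, and `p` is a feeble pullback. -/
class CoproductCondition (C : Type u) [Category.{v} C] [HasFiniteLimits C] : Prop
    extends HasFiniteCoproducts C where
  isPullback_coprod_map : ∀ {P X Y Z P' X' Y' Z' : C}
    {f : P ⟶ X} {g : P ⟶ Y} {h : X ⟶ Z} {k : Y ⟶ Z}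
    {f' : P' ⟶ X'} {g' : P' ⟶ Y'} {h' : X' ⟶ Z'} {k' : Y' ⟶ Z'},
    IsPullback f g h k → IsPullback f' g' h' k' →
      IsPullback (coprod.map f f') (coprod.map g g') (coprod.map h h') (coprod.map k k')
  isPullback_of_mono : ∀ {S A : C} (m : S ⟶ A), Mono m →
    IsPullback (coprod.map m (𝟙 S)) (coprod.desc (𝟙 S) (𝟙 S)) (coprod.desc (𝟙 A) m) m
  isFeeblePullback_of_isRegularEpi : ∀ {E B : C} (p : E ⟶ B), IsRegularEpi p →
    IsFeeblePullback (coprod.map p p) (coprod.desc (𝟙 E) (𝟙 E)) (coprod.desc (𝟙 B) (𝟙 B)) p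

namespace CategoryTheory

attribute [local simp] pullback.lift_fst pullback.lift_snd pullback.lift_fst_assoc
  pullback.lift_snd_assoc prod.lift_fst prod.lift_snd prod.lift_fst_assoc prod.lift_snd_assoc
  coprod.inl_desc coprod.inr_desc coprod.inl_desc_assoc coprod.inr_desc_assoc prod.map_fst
  prod.map_snd prod.map_fst_assoc prod.map_snd_assoc coprod.inl_map coprod.inr_map
  coprod.inl_map_assoc coprod.inr_map_assoc

/-! Coexactness reduces to two facts about monos: they are stable under pushout and regular, and a
coreflexive jointly epic pair is a cokernel pair. For the first, an equivalence relation on a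
subobject extends to the ambient object (`exists_extension_of_isKernelPair`); its quotient shows
that a pushout of a mono along a regular epi is also a pullback, and the general case follows. For
the second, unions of subobjects are effective (`mono_desc_of_isPullback`). Both rest on computing
pullbacks of coproducts: exactly along monos by (c), up to a regular epi along regular epis by (d).
-/

/-- A morphism which factors through a mono after precomposition with a regular epi already
factors through that mono. -/
lemma exists_factor_of_isRegularEpi {C : Type u} [Category.{v} C] {X Y Z R : C}
    {e : X ⟶ Y} [IsRegularEpi e] {r : R ⟶ Z} [Mono r] {g : Y ⟶ Z} {h : X ⟶ R} (w : e ≫ g = h ≫ r) : ∃ l : Y ⟶ R, l ≫ r = g :=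
  have sq : CommSq h e r g := ⟨w.symm⟩
  ⟨sq.lift, sq.fac_right⟩

section Regular

variable {C : Type u} [Category.{v} C] [Regular C]

lemma isRegularEpi_of_strongEpi {X Y : C} (f : X ⟶ Y) [StrongEpi f] : IsRegularEpi f :=
  Regular.isRegularEpi_of_extremalEpi f

lemma isRegularEpi_comp {X Y Z : C} (f : X ⟶ Y) (g : Y ⟶ Z) [IsRegularEpi f] [IsRegularEpi g] :
    IsRegularEpi (f ≫ g) :=
  have := strongEpi_comp f g
  isRegularEpi_of_strongEpi _

lemma IsPullback.isRegularEpi_fst {P X Y Z : C} {fst : P ⟶ X} {snd : P ⟶ Y} {f : X ⟶ Z}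
    {g : Y ⟶ Z} (h : IsPullback fst snd f g) [hg : IsRegularEpi g] : IsRegularEpi fst :=
  Regular.regularEpiIsStableUnderBaseChange.of_isPullback h.flip hg

lemma IsPullback.isRegularEpi_snd {P X Y Z : C} {fst : P ⟶ X} {snd : P ⟶ Y} {f : X ⟶ Z}
    {g : Y ⟶ Z} (h : IsPullback fst snd f g) [IsRegularEpi f] : IsRegularEpi snd :=
  h.flip.isRegularEpi_fst

/-- In a pullback square whose sides at the pullback are a mono `m` and a regular epi `p`, the
side opposite to `m` is a mono. -/
lemma IsPullback.mono_of_isRegularEpi {S A T B : C} {m : S ⟶ A} {p : S ⟶ T} {q : A ⟶ B}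
    {t : T ⟶ B} [Mono m] [IsRegularEpi p] (h : IsPullback m p q t) : Mono t := by
  refine ⟨fun {X} a b hab => ?_⟩
  let π := pullback.fst a p
  let a' := pullback.snd a p
  have hπ : π ≫ a = a' ≫ p := pullback.condition
  have w : (a' ≫ m) ≫ q = (π ≫ b) ≫ t := by
    rw [Category.assoc, h.w, ← reassoc_of% hπ, hab, Category.assoc]
  have hl : h.lift _ _ w = a' := by rw [← cancel_mono m, h.lift_fst]
  rw [← cancel_epi π, hπ, ← h.lift_snd _ _ w, hl]

end Regular

/-! ### Pullbacks of coproducts -/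

section CoproductCondition

variable {C : Type u} [Category.{v} C] [BarrExact C] [CoproductCondition C]

lemma IsPullback.coprod_desc_of_mono {T T' S M A : C} {i : M ⟶ A} [Mono i] {t : T ⟶ A}
    {a : T' ⟶ T} {b : T' ⟶ M} (h : IsPullback a b t i) (s : S ⟶ M) :
    IsPullback (coprod.map a (𝟙 S)) (coprod.desc b s) (coprod.desc t (s ≫ i)) i := by
  have h₁ := CoproductCondition.isPullback_coprod_map h (IsPullback.id_horiz s)
  simpa using h₁.paste_vert (CoproductCondition.isPullback_of_mono i inferInstance)

/-- By (b), `w` is a pullback of the comparison map that (d) makes a regular epi. -/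
lemma isRegularEpi_coprod_pullback {E B X Y X' Y' Z : C} {p : E ⟶ B} [hp : IsRegularEpi p]
    {f : X ⟶ B} {g : Y ⟶ B} {a : X' ⟶ X} {b : X' ⟶ E} {a' : Y' ⟶ Y} {b' : Y' ⟶ E}
    {x : Z ⟶ X ⨿ Y} {y : Z ⟶ E} (hX : IsPullback a b f p) (hY : IsPullback a' b' g p)
    (hZ : IsPullback x y (coprod.desc f g) p) {w : X' ⨿ Y' ⟶ Z} (hx : w ≫ x = coprod.map a a')
    (hy : w ≫ y = coprod.desc b b') : IsRegularEpi w := by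
  obtain ⟨c, hc⟩ := CoproductCondition.isFeeblePullback_of_isRegularEpi p hp
  have hW := IsPullback.of_hasPullback p (coprod.desc (𝟙 B) (𝟙 B))
  let z : Z ⟶ pullback p (coprod.desc (𝟙 B) (𝟙 B)) :=
    pullback.lift y (x ≫ coprod.map f g) (by simp [← hZ.w])
  have hz : IsPullback x z (coprod.map f g) (pullback.snd _ _) := by
    refine IsPullback.of_bot ?_ (by simp [z]) hW.flip
    simpa [z] using hZ
  have hsum := CoproductCondition.isPullback_coprod_map hX hY
  have : IsPullback w (coprod.map b b') z (pullback.lift _ _ c) := by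
    refine IsPullback.of_right (h₁₂ := x) ?_ ?_ hz
    · simpa [hx] using hsum
    · apply pullback.hom_ext <;> simp [z, hy, reassoc_of% hx, hsum.w]
  exact this.isRegularEpi_fst

lemma IsPullback.coprod_inl {S A : C} (m : S ⟶ A) (B : C) :
    IsPullback coprod.inl m (coprod.map m (𝟙 B)) (coprod.inl : A ⟶ A ⨿ B) := by
  have h := CoproductCondition.isPullback_coprod_map (IsPullback.id_horiz m)
    (IsPullback.id_vert (initial.to B))
  refine h.of_iso (coprod.rightUnitor S) (Iso.refl _) (coprod.rightUnitor A) (Iso.refl _)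
    ?_ ?_ ?_ ?_ <;> ext <;> simp

/-! ### Extension of equivalence relations -/

/-- An effective equivalence relation `K` on a subobject `S` of `A` extends to an effective
equivalence relation on `A` for which every element related to an element `x` of `S` lies in `S` and
is related to `x` by `K`. The extension is the image of `A ⨿ K` in `A ⨯ A`. -/
lemma exists_extension_of_isKernelPair {S A T K : C} {m : S ⟶ A} [Mono m] {p : S ⟶ T}
    {k₁ k₂ : K ⟶ S} (hK : IsKernelPair p k₁ k₂) :
    ∃ (B : C) (q : A ⟶ B), k₁ ≫ m ≫ q = k₂ ≫ m ≫ q ∧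
      ∀ {X : C} (x : X ⟶ S) (y : X ⟶ A), x ≫ m ≫ q = y ≫ q →
        ∃ k : X ⟶ K, k ≫ k₁ = x ∧ k ≫ k₂ ≫ m = y := by
  let g : A ⨿ K ⟶ A ⨯ A := coprod.desc (prod.lift (𝟙 A) (𝟙 A)) (prod.lift (k₁ ≫ m) (k₂ ≫ m))
  let F := Regular.strongEpiMonoFactorisation g
  let R := F.I
  let e : A ⨿ K ⟶ R := F.e
  let r : R ⟶ A ⨯ A := F.m
  have he : IsRegularEpi e := inferInstanceAs (IsRegularEpi F.e)
  have hr : Mono r := inferInstanceAs (Mono F.m)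
  have her : e ≫ r = g := F.fac
  let r₁ : R ⟶ A := r ≫ prod.fst
  let r₂ : R ⟶ A := r ≫ prod.snd
  have her₁ : e ≫ r₁ = coprod.desc (𝟙 A) (k₁ ≫ m) := by
    ext <;> simp [r₁, reassoc_of% her, g]
  have her₂ : e ≫ r₂ = coprod.desc (𝟙 A) (k₂ ≫ m) := by
    ext <;> simp [r₂, reassoc_of% her, g]
  have hinl₁ : coprod.inl ≫ e ≫ r₁ = 𝟙 A := by simp [her₁]
  have hinl₂ : coprod.inl ≫ e ≫ r₂ = 𝟙 A := by simp [her₂]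
  have hinr₁ : coprod.inr ≫ e ≫ r₁ = k₁ ≫ m := by simp [her₁]
  have hinr₂ : coprod.inr ≫ e ≫ r₂ = k₂ ≫ m := by simp [her₂]
  have hext {X : C} (u v : X ⟶ R) (h₁ : u ≫ r₁ = v ≫ r₁) (h₂ : u ≫ r₂ = v ≫ r₂) : u = v := by
    rw [← cancel_mono r]
    apply Limits.prod.hom_ext <;> simpa [r₁, r₂] using ‹_›
  let i : S ⨯ A ⟶ A ⨯ A := prod.map m (𝟙 A)
  let s : K ⟶ S ⨯ A := prod.lift k₁ (k₂ ≫ m)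
  have hs : Mono s := ⟨fun a b hab => by
    have h₁ := hab =≫ prod.fst
    have h₂ := hab =≫ prod.snd
    simp only [s, Category.assoc, prod.lift_fst, prod.lift_snd] at h₁ h₂
    refine hK.hom_ext h₁ ?_
    rw [← cancel_mono m]
    simpa using h₂⟩
  have hdiag : IsPullback m (prod.lift (𝟙 S) m) (prod.lift (𝟙 A) (𝟙 A)) i := by
    refine IsPullback.of_isLimit' ⟨by ext <;> simp [i]⟩ ?_
    refine PullbackCone.IsLimit.mk _ (fun c => c.snd ≫ prod.fst) ?_ ?_ ?_
    · intro c
      simpa [i] using (c.condition =≫ prod.fst).symm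
    · intro c
      have h₁ := c.condition =≫ prod.fst
      have h₂ := c.condition =≫ prod.snd
      simp only [i, Category.assoc, prod.lift_fst, prod.lift_snd, prod.map_fst, prod.map_snd,
        Category.comp_id] at h₁ h₂
      apply Limits.prod.hom_ext
      · simp
      · simp [← h₁, ← h₂]
    · intro c l h₁ h₂
      simp [← h₂]
  -- Pulled back along `i`, the cover `A ⨿ K` of `R` becomes `S ⨿ K`, whose image in `S ⨯ A` lies in
  -- `K` by reflexivity.
  have hrestr {X : C} (x : X ⟶ S) (y : X ⟶ R) (hxy : x ≫ m = y ≫ r₁) :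
      ∃ k : X ⟶ K, k ≫ k₁ = x ∧ k ≫ k₂ ≫ m = y ≫ r₂ := by
    have hg := hdiag.coprod_desc_of_mono s
    have hsi : coprod.desc (prod.lift (𝟙 A) (𝟙 A)) (s ≫ i) = g := by simp [s, i, g]
    rw [hsi, ← her] at hg
    have hR := IsPullback.of_hasPullback r i
    let w := hR.lift (coprod.map m (𝟙 K) ≫ e) (coprod.desc (prod.lift (𝟙 S) m) s)
      (by simpa using hg.w)
    have hw : IsPullback (coprod.map m (𝟙 K)) w e (pullback.fst r i) :=
      IsPullback.of_bot (by simpa [w] using hg) (by simp [w]) hR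
    have := hw.isRegularEpi_snd
    obtain ⟨l, hl⟩ := exists_factor_of_isRegularEpi (e := w) (r := s) (g := pullback.snd r i)
      (h := coprod.desc (hK.lift (𝟙 S) (𝟙 S) rfl) (𝟙 K)) (by
        ext <;> simp [w, s])
    have hX : y ≫ r = prod.lift x (y ≫ r₂) ≫ i := by
      ext <;> simp [i, hxy, r₁, r₂]
    have hk : (hR.lift _ _ hX ≫ l) ≫ s = prod.lift x (y ≫ r₂) := by
      rw [Category.assoc, hl, hR.lift_snd]
    refine ⟨hR.lift _ _ hX ≫ l, ?_, ?_⟩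
    · simpa [s] using hk =≫ prod.fst
    · simpa [s] using hk =≫ prod.snd
  have hr₁ : IsRegularEpi r₁ :=
    have : IsSplitEpi r₁ := IsSplitEpi.mk' ⟨coprod.inl ≫ e, by simpa using hinl₁⟩
    inferInstance
  -- Composable pairs in `R` are covered by `R ⨿ (K ×_A R)`, using (d) for `r₁`. On the second
  -- summand `hrestr` moves the `R`-component into `K`, which is transitive.
  have htrans : ∃ l : pullback r₂ r₁ ⟶ R,
      l ≫ r = prod.lift (pullback.fst r₂ r₁ ≫ r₁) (pullback.snd r₂ r₁ ≫ r₂) := by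
    have hP := IsPullback.of_hasPullback r₂ r₁
    have hQ := IsPullback.of_hasPullback e (pullback.fst r₂ r₁)
    have hZ := hQ.flip.paste_horiz hP.flip
    have hZ' := hZ.flip
    rw [her₂] at hZ'
    have hY := IsPullback.of_hasPullback (k₂ ≫ m) r₁
    let κ := pullback.fst (k₂ ≫ m) r₁
    let y := pullback.snd (k₂ ≫ m) r₁
    have hκ : (κ ≫ k₂) ≫ m = y ≫ r₁ := by simpa using hY.w
    obtain ⟨κ', h₁, h₂⟩ := hrestr _ _ hκ
    have hτ : (κ ≫ k₁) ≫ p = (κ' ≫ k₂) ≫ p := by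
      rw [Category.assoc, hK.w, ← Category.assoc, ← h₁, Category.assoc, hK.w, Category.assoc]
    have hcomm : coprod.map r₁ κ ≫ coprod.desc (𝟙 A) (k₂ ≫ m) = coprod.desc (𝟙 R) y ≫ r₁ := by
      ext
      · simp
      · simpa using hκ
    let w := hZ'.lift _ _ hcomm
    have hw₁ : w ≫ pullback.fst e _ = coprod.map r₁ κ := hZ'.lift_fst _ _ _
    have hw₂ : w ≫ pullback.snd e _ ≫ pullback.snd r₂ r₁ = coprod.desc (𝟙 R) y :=
      hZ'.lift_snd _ _ _
    have hw : IsRegularEpi w :=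
      isRegularEpi_coprod_pullback (IsPullback.id_vert r₁) hY hZ' hw₁ hw₂
    have := isRegularEpi_comp w (pullback.snd e (pullback.fst r₂ r₁))
    refine exists_factor_of_isRegularEpi (e := w ≫ pullback.snd e (pullback.fst r₂ r₁))
      (h := coprod.desc (𝟙 R) (hK.lift _ _ hτ ≫ coprod.inr ≫ e)) ?_
    have hc : w ≫ pullback.snd e _ ≫ pullback.fst r₂ r₁ = coprod.map r₁ κ ≫ e := by
      rw [← hQ.w, reassoc_of% hw₁]
    apply Limits.prod.hom_ext
    · simp only [Category.assoc, prod.lift_fst, reassoc_of% hc, her₁]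
      ext
      · simp [r₁]
      · simp only [coprod.inr_map_assoc, coprod.inr_desc, coprod.inr_desc_assoc, Category.assoc]
        rw [show r ≫ prod.fst = r₁ from rfl, hinr₁, IsKernelPair.lift_fst_assoc, Category.assoc]
    · simp only [Category.assoc, prod.lift_snd, reassoc_of% hw₂]
      ext
      · simp [r₂]
      · simp only [coprod.inr_desc_assoc, Category.assoc]
        rw [show r ≫ prod.snd = r₂ from rfl, hinr₂, IsKernelPair.lift_snd_assoc, Category.assoc, h₂]
  have hsymm : ∃ l : R ⟶ R, l ≫ r = prod.lift r₂ r₁ := by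
    refine exists_factor_of_isRegularEpi (e := e)
      (h := coprod.desc coprod.inl (hK.lift k₂ k₁ hK.w.symm ≫ coprod.inr) ≫ e) ?_
    rw [Category.assoc, her]
    apply Limits.prod.hom_ext
    · simp only [Category.assoc, prod.lift_fst, her₂]
      ext <;> simp [g]
    · simp only [Category.assoc, prod.lift_snd, her₁]
      ext <;> simp [g]
  obtain ⟨τ, hτ⟩ := htrans
  obtain ⟨σ, hσ⟩ := hsymm
  have hτ₁ : τ ≫ r₁ = pullback.fst r₂ r₁ ≫ r₁ := by
    rw [← prod.lift_fst (pullback.fst r₂ r₁ ≫ r₁) (pullback.snd r₂ r₁ ≫ r₂), ← hτ, Category.assoc]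
  have hτ₂ : τ ≫ r₂ = pullback.snd r₂ r₁ ≫ r₂ := by
    rw [← prod.lift_snd (pullback.fst r₂ r₁ ≫ r₁) (pullback.snd r₂ r₁ ≫ r₂), ← hτ, Category.assoc]
  have heq : EquivalenceRelation r₁ r₂ :=
    { right_cancellation := fun _ => hext
      r := coprod.inl ≫ e
      reflexivity₁ := by simpa using hinl₁
      reflexivity₂ := by simpa using hinl₂
      s := σ
      symmetry₁ := by simp [r₁, reassoc_of% hσ]
      symmetry₂ := by simp [r₂, reassoc_of% hσ]
      c := _
      isLimit := (IsPullback.of_hasPullback r₂ r₁).isLimit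
      t := τ
      transitivity₁ := hτ₁
      transitivity₂ := hτ₂ }
  obtain ⟨B, q, hq⟩ := BarrExact.exists_isKernelPair r₁ r₂ heq.isEquivalenceRelation
  refine ⟨B, q, ?_, fun x y hxy => ?_⟩
  · rw [← reassoc_of% hinr₁, ← reassoc_of% hinr₂, hq.w]
  · obtain ⟨k, h₁, h₂⟩ := hrestr x (hq.lift (x ≫ m) y (by simpa using hxy)) (by simp)
    exact ⟨k, h₁, by simpa using h₂⟩

/-! ### Pushouts of monomorphisms -/

lemma IsPushout.isPullback_and_mono_of_isRegularEpi {S A T P : C} {m : S ⟶ A} [Mono m] {p : S ⟶ T}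
    [IsRegularEpi p] {inl : A ⟶ P} {inr : T ⟶ P} (h : IsPushout m p inl inr) :
    IsPullback m p inl inr ∧ Mono inr := by
  have hK := IsKernelPair.of_hasPullback p
  obtain ⟨B, q, hq, hR⟩ := exists_extension_of_isKernelPair (m := m) hK
  let t : T ⟶ B := Cofork.IsColimit.desc hK.toCoequalizer' (m ≫ q) hq
  have ht : p ≫ t = m ≫ q := Cofork.IsColimit.π_desc' hK.toCoequalizer' _ hq
  let d : P ⟶ B := h.desc q t ht.symm
  have hinl : inl ≫ d = q := h.inl_desc _ _ _
  have hinr : inr ≫ d = t := h.inr_desc _ _ _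
  -- Equality in `P` gives equality in `B`. After `y` is lifted along `p`, the extended relation
  -- puts `x` in `S`; this descends along the cover `π`.
  have key {X : C} (x : X ⟶ A) (y : X ⟶ T) (hxy : x ≫ inl = y ≫ inr) :
      ∃ l : X ⟶ S, l ≫ m = x ∧ l ≫ p = y := by
    let π := pullback.fst y p
    let y' := pullback.snd y p
    have hπ : π ≫ y = y' ≫ p := pullback.condition
    obtain ⟨k, h₁, h₂⟩ := hR y' (π ≫ x) (by
      rw [← ht, ← reassoc_of% hπ, ← hinr, ← reassoc_of% hxy, hinl, Category.assoc])
    obtain ⟨l, hl⟩ := exists_factor_of_isRegularEpi (e := π) (r := m) (g := x)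
      (h := k ≫ pullback.snd p p) (by simpa using h₂.symm)
    refine ⟨l, hl, ?_⟩
    have hkl : π ≫ l = k ≫ pullback.snd p p := by
      rw [← cancel_mono m, Category.assoc, hl, ← h₂, Category.assoc]
    rw [← cancel_epi π, reassoc_of% hkl, ← hK.w, reassoc_of% h₁, hπ]
  have hP : IsPullback m p inl inr := by
    refine ⟨h.toCommSq, ⟨PullbackCone.IsLimit.mk _ (fun c => (key _ _ c.condition).choose)
      (fun c => (key _ _ c.condition).choose_spec.1)
      (fun c => (key _ _ c.condition).choose_spec.2) (fun c l h₁ _ => ?_)⟩⟩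
    rw [← cancel_mono m, h₁, (key _ _ c.condition).choose_spec.1]
  exact ⟨hP, hP.mono_of_isRegularEpi⟩

lemma IsPushout.coprod_map_id {S A B P : C} {m : S ⟶ A} {f : S ⟶ B} {inl : A ⟶ P} {inr : B ⟶ P}
    (h : IsPushout m f inl inr) :
    IsPushout (coprod.map m (𝟙 B)) (coprod.desc f (𝟙 B)) (coprod.desc inl inr) inr := by
  refine ⟨⟨by ext <;> simp [h.w]⟩, ⟨PushoutCocone.IsColimit.mk _
    (fun c => h.desc (coprod.inl ≫ c.inl) c.inr ?_) (fun c => ?_) (fun c => ?_)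
    (fun c l h₁ h₂ => ?_)⟩⟩
  · simpa using coprod.inl ≫= c.condition
  · have := coprod.inr ≫= c.condition
    ext
    · simp
    · simpa using this.symm
  · simp
  · apply h.hom_ext
    · simp [← h₁]
    · simpa using h₂

/-- Replacing `f` by the split epi `[f, 1]` and `m` by `m + 1` leaves the pushout object unchanged
and reduces to the regular epi case. -/
lemma IsPushout.isPullback_and_mono {S A B P : C} {m : S ⟶ A} [Mono m] {f : S ⟶ B}
    {inl : A ⟶ P} {inr : B ⟶ P} (h : IsPushout m f inl inr) :
    IsPullback m f inl inr ∧ Mono inr := by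
  have hm := IsPullback.coprod_inl m B
  have : Mono (coprod.map m (𝟙 B)) := by
    have h₁ := CoproductCondition.isPullback_coprod_map (IsKernelPair.id_of_mono m)
      (IsKernelPair.id_of_mono (𝟙 B))
    exact IsKernelPair.mono_of_eq_fst_snd h₁ rfl
  have : IsSplitEpi (coprod.desc f (𝟙 B)) := IsSplitEpi.mk' ⟨coprod.inr, by simp⟩
  obtain ⟨h₁, h₂⟩ := h.coprod_map_id.isPullback_and_mono_of_isRegularEpi
  refine ⟨?_, h₂⟩
  simpa using hm.flip.paste_vert h₁

instance (priority := low) isRegularMono_of_mono_of_coproductCondition [HasFiniteColimits C]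
    {S A : C} (m : S ⟶ A) [Mono m] : IsRegularMono m := by
  have h := (IsPushout.of_hasPushout m m).isPullback_and_mono.1
  refine ⟨⟨⟨_, pushout.inl m m, pushout.inr m m, pushout.condition, ?_⟩⟩⟩
  exact Fork.IsLimit.mk _ (fun c => h.lift c.ι c.ι c.condition) (fun c => h.lift_fst _ _ _)
    (fun c l hl => by rw [← cancel_mono m]; simpa using hl)

/-! ### Effective unions and cokernel pairs -/

lemma IsPushout.isRegularEpi_coprod_desc {S A B P : C} {s : S ⟶ A} {s' : S ⟶ B} {inl : A ⟶ P}
    {inr : B ⟶ P} (hP : IsPushout s s' inl inr) : IsRegularEpi (coprod.desc inr inl) := by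
  refine ⟨⟨⟨S, s' ≫ coprod.inl, s ≫ coprod.inr, by simp [hP.w], ?_⟩⟩⟩
  refine Cofork.IsColimit.mk _
    (fun c => hP.desc (coprod.inr ≫ c.π) (coprod.inl ≫ c.π) (by simpa using c.condition.symm))
    (fun c => ?_) (fun c l hl => ?_)
  · ext <;> simp
  · apply hP.hom_ext <;> simp [← hl]

/-- Let `P` be the pushout of subobjects `A` and `B` of `Q` over their intersection. Then the part
of `P` lying over `A` is `A` itself. -/
lemma eq_comp_inl_of_comp_eq {S A B P Q : C} {s : S ⟶ A} {s' : S ⟶ B} {a : A ⟶ Q} {b : B ⟶ Q}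
    [Mono a] (hS : IsPullback s s' a b) {inl : A ⟶ P} {inr : B ⟶ P} (hP : IsPushout s s' inl inr)
    {h : P ⟶ Q} (hl : inl ≫ h = a) (hr : inr ≫ h = b) {X : C} {x : X ⟶ P} {y : X ⟶ A}
    (hxy : x ≫ h = y ≫ a) : x = y ≫ inl := by
  have he := hP.isRegularEpi_coprod_desc
  have hD := hS.flip.coprod_desc_of_mono (𝟙 A)
  have hdesc : coprod.desc b (𝟙 A ≫ a) = coprod.desc inr inl ≫ h := by ext <;> simp [hl, hr]
  rw [hdesc] at hD
  have hG := IsPullback.of_hasPullback h a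
  let w := hG.lift (coprod.map s' (𝟙 A) ≫ coprod.desc inr inl) (coprod.desc s (𝟙 A))
    (by simpa using hD.w)
  have hw : IsPullback (coprod.map s' (𝟙 A)) w (coprod.desc inr inl) (pullback.fst h a) :=
    IsPullback.of_bot (by simpa [w] using hD) (by simp [w]) hG
  have := hw.isRegularEpi_snd
  -- `w` covers the part of `P` over `A` by `S ⨿ A`; on `S` the two maps agree by the pushout
  -- relation.
  have key : pullback.fst h a = pullback.snd h a ≫ inl := by
    rw [← cancel_epi w]
    ext <;> simp [w, hP.w]
  have hx := hG.lift x y hxy ≫= key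
  rwa [hG.lift_fst, hG.lift_snd_assoc] at hx

/-- By (d) for `h`, its kernel pair is covered by the parts of `P` over `B` and over `A`, where
`eq_comp_inl_of_comp_eq` makes the projections agree. -/
lemma mono_desc_of_isPullback_of_isRegularEpi {S A B P Q : C} {s : S ⟶ A} {s' : S ⟶ B} {a : A ⟶ Q}
    {b : B ⟶ Q} [Mono a] [Mono b] (hS : IsPullback s s' a b) {inl : A ⟶ P} {inr : B ⟶ P}
    (hP : IsPushout s s' inl inr) {h : P ⟶ Q} [IsRegularEpi h] (hl : inl ≫ h = a)
    (hr : inr ≫ h = b) : Mono h := by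
  have he := hP.isRegularEpi_coprod_desc
  have hK := IsPullback.of_hasPullback h h
  have hQ := IsPullback.of_hasPullback (coprod.desc inr inl) (pullback.fst h h)
  have hZ := (hQ.flip.paste_horiz hK.flip).flip
  have hdesc : coprod.desc inr inl ≫ h = coprod.desc b a := by ext <;> simp [hl, hr]
  rw [hdesc] at hZ
  have hB := IsPullback.of_hasPullback b h
  have hA := IsPullback.of_hasPullback a h
  let w := hZ.lift (coprod.map (pullback.fst b h) (pullback.fst a h))
    (coprod.desc (pullback.snd b h) (pullback.snd a h)) (by ext <;> simp [hA.w, hB.w])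
  have hw₁ : w ≫ pullback.fst _ _ = _ := hZ.lift_fst _ _ _
  have hw₂ : w ≫ pullback.snd _ _ ≫ pullback.snd h h = _ := hZ.lift_snd _ _ _
  have hw : IsRegularEpi w := isRegularEpi_coprod_pullback hB hA hZ hw₁ hw₂
  refine IsKernelPair.mono_of_eq_fst_snd hK ?_
  rw [← cancel_epi (w ≫ pullback.snd (coprod.desc inr inl) (pullback.fst h h)), Category.assoc,
    Category.assoc, hw₂, ← hQ.w, reassoc_of% hw₁]
  ext
  · simpa using (eq_comp_inl_of_comp_eq hS.flip hP.flip hr hl hB.w.symm).symm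
  · simpa using (eq_comp_inl_of_comp_eq hS hP hl hr hA.w.symm).symm

/-- Unions of subobjects are effective. -/
lemma mono_desc_of_isPullback {S A B P Q : C} {s : S ⟶ A} {s' : S ⟶ B} {a : A ⟶ Q} {b : B ⟶ Q}
    [ha : Mono a] [hb : Mono b] (hS : IsPullback s s' a b) {inl : A ⟶ P} {inr : B ⟶ P}
    (hP : IsPushout s s' inl inr) {h : P ⟶ Q} (hl : inl ≫ h = a) (hr : inr ≫ h = b) : Mono h := by
  -- Condition (d) needs a regular epi, so `Q` is replaced by the image of `h`.
  let F := Regular.strongEpiMonoFactorisation h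
  have : IsRegularEpi F.e := inferInstanceAs (IsRegularEpi (Regular.strongEpiMonoFactorisation h).e)
  have hla : (inl ≫ F.e) ≫ F.m = a := by simp [hl]
  have hrb : (inr ≫ F.e) ≫ F.m = b := by simp [hr]
  rw [← hla] at ha
  rw [← hrb] at hb
  have := mono_of_mono (inl ≫ F.e) F.m
  have := mono_of_mono (inr ≫ F.e) F.m
  have hS' : IsPullback s s' (inl ≫ F.e) (inr ≫ F.e) := by
    rw [← hla, ← hrb] at hS
    refine ⟨⟨by rw [← cancel_mono F.m]; simpa only [Category.assoc] using hS.w⟩,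
      ⟨PullbackCone.IsLimit.mk _ (fun c => hS.lift c.fst c.snd ?_) (fun c => hS.lift_fst _ _ _)
        (fun c => hS.lift_snd _ _ _) (fun c l h₁ h₂ => hS.hom_ext ?_ ?_)⟩⟩
    · simpa using c.condition =≫ F.m
    · rw [h₁, hS.lift_fst]
    · rw [h₂, hS.lift_snd]
  have := mono_desc_of_isPullback_of_isRegularEpi hS' hP rfl rfl
  rw [← F.fac]
  infer_instance

/-- A jointly epic pair `i₁ i₂ : A ⟶ Q` with a common retraction is the cokernel pair of its
equalizer. -/
lemma isPushout_equalizer_of_coreflexive [HasFiniteColimits C] {A Q : C} {i₁ i₂ : A ⟶ Q}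
    (hepi : ∀ {X : C} (f g : Q ⟶ X), i₁ ≫ f = i₁ ≫ g → i₂ ≫ f = i₂ ≫ g → f = g)
    (r : Q ⟶ A) (h₁ : i₁ ≫ r = 𝟙 A) (h₂ : i₂ ≫ r = 𝟙 A) :
    IsPushout (equalizer.ι i₁ i₂) (equalizer.ι i₁ i₂) i₁ i₂ := by
  have : IsSplitMono i₁ := IsSplitMono.mk' ⟨r, h₁⟩
  have : IsSplitMono i₂ := IsSplitMono.mk' ⟨r, h₂⟩
  -- The common retraction makes the equalizer the intersection of `i₁` and `i₂`.
  have hfork {X : C} (x y : X ⟶ A) (h : x ≫ i₁ = y ≫ i₂) : x = y := by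
    simpa [h₁, h₂] using h =≫ r
  have hS : IsPullback (equalizer.ι i₁ i₂) (equalizer.ι i₁ i₂) i₁ i₂ := by
    refine ⟨⟨equalizer.condition i₁ i₂⟩, ⟨PullbackCone.IsLimit.mk _
      (fun c => equalizer.lift c.fst ?_) (fun c => ?_) (fun c => ?_) (fun c l hl _ => ?_)⟩⟩
    · rw [c.condition, hfork _ _ c.condition]
    · exact equalizer.lift_ι _ _
    · exact (equalizer.lift_ι _ _).trans (hfork _ _ c.condition)
    · rw [← cancel_mono (equalizer.ι i₁ i₂), hl, equalizer.lift_ι]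
  have hP := IsPushout.of_hasPushout (equalizer.ι i₁ i₂) (equalizer.ι i₁ i₂)
  let h := hP.desc i₁ i₂ hS.w
  have hl : _ ≫ h = i₁ := hP.inl_desc _ _ _
  have hr : _ ≫ h = i₂ := hP.inr_desc _ _ _
  have : Mono h := mono_desc_of_isPullback hS hP hl hr
  have : Epi h := ⟨fun f g hfg => hepi f g
    (by simp only [← hl, Category.assoc, hfg]) (by simp only [← hr, Category.assoc, hfg])⟩
  have : IsIso h := isIso_of_regularMono_of_epi h (IsRegularMono.getStruct h)
  exact hP.of_iso (Iso.refl _) (Iso.refl _) (Iso.refl _) (asIso h) (by simp) (by simp)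
    (by simpa using hl) (by simpa using hr)

end CoproductCondition

end CategoryTheory

theorem mainTheorem2 (C : Type u) [Category.{v} C] [BarrExact C] [CoproductCondition C]
    [HasFiniteColimits C] : BarrCoexact C := by
  refine { exists_isKernelPair := ?_, hasCoequalizer_of_isKernelPair := ?_,
           regularEpiIsStableUnderBaseChange := ?_ }
  · intro _ _ _ _ _ _ _
    infer_instance
  -- Dually: monos are stable under pushout, and every mono is regular.
  · refine ⟨fun {X Y Y' S f g f' g'} sq hg => ?_⟩
    have : IsRegularEpi g := hg
    have : Mono g.unop := inferInstance
    have := sq.unop.flip.isPullback_and_mono.2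
    exact (isRegularMono_unop_iff_isRegularEpi g').1 inferInstance
  · rintro R A r₁ r₂ ⟨⟨e⟩⟩
    have h := isPushout_equalizer_of_coreflexive (i₁ := r₁.unop) (i₂ := r₂.unop)
      (fun f g h₁ h₂ => Quiver.Hom.op_inj
        (e.right_cancellation f.op g.op (Quiver.Hom.unop_inj h₁) (Quiver.Hom.unop_inj h₂)))
      e.r.unop (Quiver.Hom.op_inj e.reflexivity₁) (Quiver.Hom.op_inj e.reflexivity₂)
    exact ⟨_, _, h.op.flip⟩
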